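/- For a finite group $G$ and a subgroup $H\le G$ let $$d(H,G)=\frac{\#\{(h,g)\in H\times G : hg=gh\}}{|H||G|}$$ and let $\mathcal{D}(G)=\{d(H,G) : H\le G\}$. Let $G$ be a finite nilpotent group with centre $Z(G)$. Then $|\mathcal{D}(G)|=5$ if and only if one of the following holds for some prime $p$: (i) $|G/Z(G)|=p^3$ and $G$ has a maximal subgroup that is abelian; (ii) $|G/Z(G)|=p^4$ and, for some $m\in\{1,2,3\}$, the set of sizes of the conjugacy classes of $G$ is exactly $\{1,p^m\}$. Moreover, in case (i) $$\mathcal{D}(G)=\left\{1,\ \frac{2p-1}{p^2},\ \frac{p^2+p-1}{p^3},\ \frac{3p-2}{p^3},\ \frac{2p^2-1}{p^4}\right\},$$ and in case (ii) $$\mathcal{D}(G)=\left\{1,\ \frac{p^m+p-1}{p^{m+1}},\ \frac{p^m+p^2-1}{p^{m+2}},\ \frac{p^m+p^3-1}{p^{m+3}},\ \frac{p^m+p^4-1}{p^{m+4}}\right\}.$$ -/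

import Mathlib

/-- The relative commutativity degree `d(H, G)` of a subgroup `H` of a finite group `G`: the
proportion of commuting pairs in `H × G`. -/
noncomputable def relCommDegree {G : Type*} [Group G] (H : Subgroup G) : ℚ :=
  (Nat.card {x : H × G // (x.1 : G) * x.2 = x.2 * (x.1 : G)} : ℚ) /
    ((Nat.card H : ℚ) * (Nat.card G : ℚ))

/-- The set `𝒟(G)` of all relative commutativity degrees of subgroups of `G`. -/
def relCommDegrees (G : Type*) [Group G] : Set ℚ :=
  Set.range fun H : Subgroup G => relCommDegree H

/-- The set of sizes of the conjugacy classes of `G`. -/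
noncomputable def conjClassSizes (G : Type*) [Group G] : Set ℕ :=
  Set.range fun c : ConjClasses G => c.carrier.ncard

/-- `G` has a maximal subgroup that is abelian. -/
def HasAbelianMaximalSubgroup (G : Type*) [Group G] : Prop :=
  ∃ M : Subgroup G, IsCoatom M ∧ ∀ x ∈ M, ∀ y ∈ M, x * y = y * x

/-- `|G/Z(G)| = p ^ 3` and `G` has an abelian maximal subgroup. -/
def CubeCase (G : Type*) [Group G] (p : ℕ) : Prop :=
  Nat.card (G ⧸ Subgroup.center G) = p ^ 3 ∧ HasAbelianMaximalSubgroup G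

/-- `|G/Z(G)| = p ^ 4`, and the conjugacy class sizes of `G` are exactly `1` and `p ^ m`, where
`m` is `1`, `2` or `3`. -/
def FourthPowerCase (G : Type*) [Group G] (p m : ℕ) : Prop :=
  Nat.card (G ⧸ Subgroup.center G) = p ^ 4 ∧ m ∈ ({1, 2, 3} : Set ℕ) ∧
    conjClassSizes G = {1, p ^ m}

/-! Counting commuting pairs in two ways, `d(H, G)` is the average over `h ∈ H` of `1 / |G : C(h)|`
and also the average over `g ∈ G` of `1 / |H : C_H(g)|`. It depends only on the image of `H` in `Q =
G/Z(G)`, so the argument runs in `Q` with the subgroups `C x` of cosets commuting with `x`; this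
system is faithful (`C x = ⊤` only for `x = 1`). The second average strictly decreases from `H` to
`K ≥ H` once a single index `|H : C_H(g)|` grows.

If `|Q| = p ^ n`, some chain with one subgroup of each order has strictly decreasing degrees, so
there are at least `n + 1` values, and exactly `n + 1` if all `C x`, `x ≠ 1`, have the same index.
Hence five values force `n = 4`, or `n = 3` with some `C x` of index `p`; such a `C x` lifts to an
abelian maximal subgroup. For `n = 4` a strict chain of five degrees is all of `𝒟(G)`, and comparing
other subgroups with a chain through a small `C x` makes the index constant
(`Faithful.index_eq_cube`, `Faithful.index_ne_prime_of_index_eq_sq`).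

Nilpotency serves to show that `|Q|` is a prime power: with two primes, two chains of five through
different Sylow subgroups have the same second largest term, a rational in `(0, 1)` whose
denominator is a power of both primes. -/

open Subgroup

/-- A symmetric, reflexive relation on a group all of whose sections are subgroups. -/
structure CommSystem (Q : Type*) [Group Q] where
  /-- The section of the relation at an element. -/
  C : Q → Subgroup Q
  symm : ∀ {x y : Q}, x ∈ C y → y ∈ C x
  self : ∀ x : Q, x ∈ C x

/-! ### Degrees of subgroups in a commuting system -/

namespace CommSystem

variable {Q : Type*} [Group Q] (S : CommSystem Q)

theorem one_mem_C (x : Q) : 1 ∈ S.C x := (S.C x).one_mem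

theorem C_one : S.C 1 = ⊤ := by
  rw [eq_top_iff]
  intro x _
  exact S.symm (S.one_mem_C x)

/-- If `g` is related to `x`, the subgroup `C g` contains `x` and so all its powers. This allows an
element to be replaced by a power of prime order. -/
theorem C_le_of_mem_zpowers {x y : Q} (h : y ∈ zpowers x) : S.C x ≤ S.C y := by
  intro g hg
  refine S.symm ?_
  have : zpowers x ≤ S.C g := by
    rw [zpowers_le]; exact S.symm hg
  exact this h

theorem _root_.Subgroup.natCard_inf_mul_relIndex (H K : Subgroup Q) :
    Nat.card (H ⊓ K : Subgroup Q) * K.relIndex H = Nat.card H := by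
  have := relIndex_mul_relIndex (⊥ : Subgroup Q) (H ⊓ K) H bot_le inf_le_left
  rwa [relIndex_bot_left, relIndex_bot_left, inf_relIndex_left] at this

theorem _root_.Subgroup.relIndex_ne_zero_of_finite [Finite Q] (H K : Subgroup Q) :
    H.relIndex K ≠ 0 :=
  FiniteIndex.index_ne_zero

variable [Fintype Q]

open Classical in
/-- The average over `H` of the reciprocal of the index of `C h`. -/
noncomputable def deg (H : Subgroup Q) : ℚ :=
  (∑ h : Q, if h ∈ H then ((S.C h).index : ℚ)⁻¹ else 0) / Nat.card H

theorem sum_ite_mem_eq_card (H : Subgroup Q) [DecidablePred (· ∈ H)] :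
    (∑ h : Q, if h ∈ H then (1 : ℚ) else 0) = Nat.card H := by
  rw [Finset.sum_boole, Nat.card_eq_fintype_card, Fintype.card_subtype]

theorem deg_eq_sum_relIndex (H : Subgroup Q) :
    S.deg H = (∑ g : Q, ((S.C g).relIndex H : ℚ)⁻¹) / Nat.card Q := by
  classical
  have hQ : (Nat.card Q : ℚ) ≠ 0 := by exact_mod_cast Nat.card_pos.ne'
  have hH : (Nat.card H : ℚ) ≠ 0 := by exact_mod_cast Nat.card_pos.ne'
  have h1 : ∀ h : Q, ((S.C h).index : ℚ)⁻¹ =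
      (∑ g : Q, if g ∈ S.C h then (1 : ℚ) else 0) / Nat.card Q := by
    intro h
    have h0 : ((S.C h).index : ℚ) ≠ 0 := by exact_mod_cast FiniteIndex.index_ne_zero
    rw [sum_ite_mem_eq_card, ← (S.C h).card_mul_index]
    have : (Nat.card (S.C h) : ℚ) ≠ 0 := by exact_mod_cast Nat.card_pos.ne'
    push_cast
    field_simp
  have h2 : ∀ g : Q, ((S.C g).relIndex H : ℚ)⁻¹ =
      (∑ h : Q, if h ∈ H ⊓ S.C g then (1 : ℚ) else 0) / Nat.card H := by
    intro g
    rw [sum_ite_mem_eq_card, ← natCard_inf_mul_relIndex H (S.C g)]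
    have : (Nat.card (H ⊓ S.C g : Subgroup Q) : ℚ) ≠ 0 := by exact_mod_cast Nat.card_pos.ne'
    have : ((S.C g).relIndex H : ℚ) ≠ 0 := by exact_mod_cast (relIndex_ne_zero_of_finite _ _)
    push_cast
    field_simp
  have h3 : (∑ h : Q, if h ∈ H then (∑ g : Q, if g ∈ S.C h then (1 : ℚ) else 0) else 0) =
      ∑ g : Q, ∑ h : Q, if h ∈ H ⊓ S.C g then (1 : ℚ) else 0 := by
    rw [Finset.sum_comm]
    refine Finset.sum_congr rfl fun h _ => ?_
    split_ifs with hh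
    · refine Finset.sum_congr rfl fun g _ => ?_
      have : g ∈ S.C h ↔ h ∈ H ⊓ S.C g :=
        ⟨fun h' => ⟨hh, S.symm h'⟩, fun h' => S.symm h'.2⟩
      simp only [this]
    · refine (Finset.sum_eq_zero fun g _ => ?_).symm
      rw [if_neg]
      exact fun h' => hh h'.1
  have h4 : (∑ h : Q, if h ∈ H then ((S.C h).index : ℚ)⁻¹ else 0) =
      (∑ h : Q, if h ∈ H then (∑ g : Q, if g ∈ S.C h then (1 : ℚ) else 0) else 0)
        / Nat.card Q := by
    rw [Finset.sum_div]
    refine Finset.sum_congr rfl fun h _ => ?_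
    split_ifs
    · exact h1 h
    · simp
  rw [deg, h4, h3, Finset.sum_congr rfl fun g _ => h2 g, ← Finset.sum_div, div_right_comm]

theorem deg_lt_deg_of_relIndex_lt {H K : Subgroup Q} (hHK : H ≤ K) (g : Q)
    (hg : (S.C g).relIndex H < (S.C g).relIndex K) : S.deg K < S.deg H := by
  rw [deg_eq_sum_relIndex, deg_eq_sum_relIndex]
  have hQ : (0 : ℚ) < Nat.card Q := by exact_mod_cast Nat.card_pos
  have hpos : ∀ (x : Q) (L : Subgroup Q), (0 : ℚ) < (S.C x).relIndex L := fun x L => by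
    exact_mod_cast Nat.pos_of_ne_zero (relIndex_ne_zero_of_finite _ _)
  refine div_lt_div_of_pos_right (Finset.sum_lt_sum (fun x _ => ?_) ⟨g, Finset.mem_univ g, ?_⟩) hQ
  · exact inv_anti₀ (hpos x H) (by exact_mod_cast relIndex_le_of_le_right hHK (relIndex_ne_zero_of_finite _ _))
  · exact inv_strictAnti₀ (hpos g H) (by exact_mod_cast hg)

theorem deg_lt_deg_of_le_C {H K : Subgroup Q} (hHK : H ≤ K) (g : Q) (hH : H ≤ S.C g)
    (hK : ¬ K ≤ S.C g) : S.deg K < S.deg H := by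
  refine S.deg_lt_deg_of_relIndex_lt hHK g ?_
  rw [relIndex_eq_one.2 hH]
  have h0 : (S.C g).relIndex K ≠ 0 := (relIndex_ne_zero_of_finite _ _)
  have h1 : (S.C g).relIndex K ≠ 1 := fun h => hK (relIndex_eq_one.1 h)
  omega

/-- `H` and `K` meet `C g` in the same subgroup, so the index of that intersection is multiplied by
`|K : H| > 1` on passing from `H` to `K`. -/
theorem deg_lt_deg_of_inf_C_le {H K : Subgroup Q} (hHK : H < K) (g : Q) (hH : K ⊓ S.C g ≤ H) :
    S.deg K < S.deg H := by
  refine S.deg_lt_deg_of_relIndex_lt hHK.le g ?_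
  have e : H ⊓ S.C g = K ⊓ S.C g :=
    le_antisymm (inf_le_inf_right _ hHK.le) (le_inf hH inf_le_right)
  have h := relIndex_mul_relIndex (K ⊓ S.C g) H K hH hHK.le
  rw [inf_relIndex_left, ← e, inf_relIndex_left] at h
  have h0 : (S.C g).relIndex H ≠ 0 := (relIndex_ne_zero_of_finite _ _)
  have h2 : H.relIndex K ≠ 0 := (relIndex_ne_zero_of_finite _ _)
  have h1 : H.relIndex K ≠ 1 := fun h => hHK.not_ge (relIndex_eq_one.1 h)
  rw [← h]
  exact lt_mul_of_one_lt_right (by omega) (by omega)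

theorem deg_bot : S.deg ⊥ = 1 := by
  rw [deg_eq_sum_relIndex]
  simp [relIndex_bot_right]

theorem deg_pos (H : Subgroup Q) : 0 < S.deg H := by
  rw [deg_eq_sum_relIndex]
  refine div_pos (Finset.sum_pos (fun x _ => ?_) Finset.univ_nonempty)
    (by exact_mod_cast Nat.card_pos)
  exact inv_pos.2 (by exact_mod_cast Nat.pos_of_ne_zero (relIndex_ne_zero_of_finite _ _))

theorem deg_eq_of_const {H : Subgroup Q} {c : ℕ}
    (hc : ∀ h ∈ H, h ≠ 1 → (S.C h).index = c) :
    S.deg H = (1 + ((Nat.card H : ℚ) - 1) * (c : ℚ)⁻¹) / Nat.card H := by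
  classical
  rw [deg]
  congr 1
  -- The first term corrects the identity, where the index is 1 instead of `c`.
  have : ∀ h : Q, (if h ∈ H then ((S.C h).index : ℚ)⁻¹ else 0) =
      (if h = 1 then 1 - (c : ℚ)⁻¹ else 0) + (c : ℚ)⁻¹ * (if h ∈ H then 1 else 0) := by
    intro h
    by_cases h1 : h = 1
    · subst h1
      simp [C_one, H.one_mem]
    · by_cases hH : h ∈ H
      · simp [h1, hH, hc h hH h1]
      · simp [h1, hH]
  rw [Finset.sum_congr rfl fun h _ => this h, Finset.sum_add_distrib, ← Finset.mul_sum,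
    sum_ite_mem_eq_card]
  simp
  ring

end CommSystem

theorem Subgroup.exists_card_pow_between {Q : Type*} [Group Q] [Finite Q] {p i : ℕ}
    [Fact p.Prime] {L K : Subgroup Q} (hLK : L < K) (hK : Nat.card K = p ^ (i + 1)) :
    ∃ H : Subgroup Q, L ≤ H ∧ H < K ∧ Nat.card H = p ^ i := by
  have hp : p.Prime := Fact.out
  obtain ⟨k, hk, hLk⟩ := (Nat.dvd_prime_pow hp).1 (hK ▸ card_dvd_of_le hLK.le)
  have hki : k ≤ i := by
    by_contra h
    have : k = i + 1 := by omega
    subst this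
    exact hLK.ne (eq_of_le_of_card_ge hLK.le (by rw [hLk, hK]))
  have hcard : Nat.card (L.subgroupOf K) = p ^ k := by
    rw [Nat.card_congr (subgroupOfEquivOfLe hLK.le).toEquiv, hLk]
  obtain ⟨H, hH, hLH⟩ := Sylow.exists_subgroup_card_pow_prime_le p (n := k) (m := i)
    (G := K) (by rw [hK]; exact pow_dvd_pow p (Nat.le_succ i)) (L.subgroupOf K) hcard hki
  have hH' : Nat.card (H.map K.subtype) = p ^ i := by
    rw [← hH]; exact (Nat.card_congr (H.equivMapOfInjective _ K.subtype_injective).toEquiv).symm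
  refine ⟨H.map K.subtype, ?_, lt_of_le_of_ne (map_subtype_le H) ?_, hH'⟩
  · intro x hx
    exact ⟨⟨x, hLK.le hx⟩, hLH (mem_subgroupOf.2 hx), rfl⟩
  · intro h
    rw [h, hK] at hH'
    exact absurd (Nat.pow_right_injective hp.two_le hH') (by omega)

/-! ### Faithful systems on groups of prime power order -/

namespace CommSystem

variable {Q : Type*} [Group Q] (S : CommSystem Q)

/-- Only the identity is related to everything. -/
def Faithful : Prop := ∀ x : Q, S.C x = ⊤ → x = 1

variable {S}

theorem Faithful.exists_not_le (hS : S.Faithful) {K : Subgroup Q} (hK : K ≠ ⊥) :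
    ∃ g, ¬ K ≤ S.C g := by
  obtain ⟨k, hk, hk1⟩ := K.bot_or_exists_ne_one.resolve_left hK
  by_contra! h
  exact hk1 (hS k (eq_top_iff.2 fun g _ => S.symm (h g hk)))

/-- In a group of order `p ^ n`, the subgroup `C x` with `x ≠ 1` is neither trivial nor everything. -/
theorem Faithful.exists_index_eq (hS : S.Faithful) [Finite Q] {p n : ℕ} [Fact p.Prime]
    (hn : Nat.card Q = p ^ n) {x : Q} (hx : x ≠ 1) :
    ∃ j, 1 ≤ j ∧ j < n ∧ (S.C x).index = p ^ j ∧ Nat.card (S.C x) = p ^ (n - j) := by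
  have hp : p.Prime := Fact.out
  have hmul := (S.C x).card_mul_index
  rw [hn] at hmul
  obtain ⟨j, hj, hij⟩ := (Nat.dvd_prime_pow hp).1 (Dvd.intro_left _ hmul)
  have hcard : Nat.card (S.C x) = p ^ (n - j) := by
    have : Nat.card (S.C x) * p ^ j = p ^ (n - j) * p ^ j := by
      rw [← hij, hmul, hij, ← pow_add]; congr 1; omega
    exact Nat.eq_of_mul_eq_mul_right (pow_pos hp.pos j) this
  refine ⟨j, ?_, ?_, hij, hcard⟩
  · by_contra h
    have : j = 0 := by omega
    subst this
    exact hx (hS x (index_eq_one.1 (by simpa using hij)))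
  · by_contra h
    have : n - j = 0 := by omega
    rw [this, pow_zero, card_eq_one] at hcard
    have := S.self x
    rw [hcard, mem_bot] at this
    exact hx this

variable [Fintype Q]

theorem Faithful.deg_lt_one (hS : S.Faithful) {K : Subgroup Q} (hK : K ≠ ⊥) : S.deg K < 1 := by
  obtain ⟨g, hg⟩ := hS.exists_not_le hK
  rw [← S.deg_bot]
  exact S.deg_lt_deg_of_le_C bot_le g bot_le hg

variable {p : ℕ} [Fact p.Prime]

/-- Take `g` with `K` not inside `C g`, and a subgroup of index `p` in `K` containing `K ⊓ C g`. -/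
theorem Faithful.exists_lt_deg_lt (hS : S.Faithful) {i : ℕ} {K : Subgroup Q}
    (hK : Nat.card K = p ^ (i + 1)) :
    ∃ H < K, Nat.card H = p ^ i ∧ S.deg K < S.deg H := by
  have hp : p.Prime := Fact.out
  obtain ⟨g, hg⟩ := hS.exists_not_le (K := K) (by
    rintro rfl
    rw [card_bot] at hK
    exact (Nat.one_lt_pow (by omega) hp.one_lt).ne hK)
  obtain ⟨H, hLH, hHK, hH⟩ := exists_card_pow_between
    (lt_of_le_of_ne (inf_le_left (b := S.C g)) fun h => hg (inf_eq_left.1 h)) hK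
  exact ⟨H, hHK, hH, S.deg_lt_deg_of_inf_C_le hHK g hLH⟩

theorem Faithful.exists_finset_deg (hS : S.Faithful) {i : ℕ} {K : Subgroup Q}
    (hK : Nat.card K = p ^ i) :
    ∃ s : Finset ℚ, s.card = i + 1 ∧ ∀ v ∈ s, v ∈ Set.range S.deg ∧ S.deg K ≤ v := by
  induction i generalizing K with
  | zero => exact ⟨{S.deg K}, by simp⟩
  | succ i ih =>
    obtain ⟨H, hHK, hH, hlt⟩ := hS.exists_lt_deg_lt hK
    obtain ⟨s, hs, hsv⟩ := ih hH
    refine ⟨insert (S.deg K) s, ?_, ?_⟩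
    · rw [Finset.card_insert_of_notMem, hs]
      intro h
      exact absurd (hsv _ h).2 (not_le.2 hlt)
    · intro v hv
      rcases Finset.mem_insert.1 hv with rfl | hv
      · exact ⟨⟨K, rfl⟩, le_rfl⟩
      · exact ⟨(hsv v hv).1, hlt.le.trans (hsv v hv).2⟩

theorem Faithful.lt_ncard_range_deg (hS : S.Faithful) {n : ℕ} (hn : Nat.card Q = p ^ n) :
    n + 1 ≤ (Set.range S.deg).ncard := by
  obtain ⟨s, hs, hsv⟩ := hS.exists_finset_deg (K := ⊤) (by rwa [card_top])
  rw [← hs, ← Set.ncard_coe_finset]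
  exact Set.ncard_le_ncard (fun v hv => (hsv v hv).1) (Set.toFinite _)

/-- The degree is then a function of the order alone, and every divisor of `p ^ n` is the order of a
subgroup. -/
theorem range_deg_eq_of_const {n c : ℕ} (hn : Nat.card Q = p ^ n)
    (hc : ∀ x : Q, x ≠ 1 → (S.C x).index = c) :
    Set.range S.deg =
      (fun i : ℕ => (1 + ((p : ℚ) ^ i - 1) * (c : ℚ)⁻¹) / (p : ℚ) ^ i) '' Set.Iio (n + 1) := by
  have hp : p.Prime := Fact.out
  ext v
  constructor
  · rintro ⟨H, rfl⟩
    obtain ⟨i, hi, hHi⟩ := (Nat.dvd_prime_pow hp).1 (hn ▸ card_subgroup_dvd_card H)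
    refine ⟨i, Nat.lt_succ_of_le hi, ?_⟩
    rw [S.deg_eq_of_const fun h _ => hc h, hHi]
    push_cast
    rfl
  · rintro ⟨i, hi, rfl⟩
    obtain ⟨H, hH⟩ := Sylow.exists_subgroup_card_pow_prime p (G := Q) (n := i)
      (by rw [hn]; exact pow_dvd_pow p (Nat.le_of_lt_succ hi))
    refine ⟨H, ?_⟩
    rw [S.deg_eq_of_const fun h _ => hc h, hH]
    push_cast
    rfl

theorem ncard_range_deg_le_of_const {n c : ℕ} (hn : Nat.card Q = p ^ n)
    (hc : ∀ x : Q, x ≠ 1 → (S.C x).index = c) : (Set.range S.deg).ncard ≤ n + 1 := by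
  rw [range_deg_eq_of_const hn hc]
  refine (Set.ncard_image_le (Set.finite_Iio _)).trans ?_
  rw [Set.ncard_eq_toFinset_card', Set.toFinset_Iio, Nat.card_Iio]

theorem Faithful.exponent_eq_of_ncard (hS : S.Faithful) {n : ℕ} (hn : Nat.card Q = p ^ n)
    (h5 : (Set.range S.deg).ncard = 5) :
    n = 3 ∧ (∃ x : Q, (S.C x).index = p) ∨ n = 4 := by
  have hle := hS.lt_ncard_range_deg hn
  by_contra! hcon
  have : ∃ c, ∀ x : Q, x ≠ 1 → (S.C x).index = c := by
    -- Here `n ≤ 3`. The exponent lies in `[1, n - 1]`, which leaves only `n - 1` unless `n = 3` and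
    -- the index is `p`, the excluded case. Constant index then allows at most four values.
    refine ⟨p ^ (n - 1), fun x hx => ?_⟩
    obtain ⟨j, h1, h2, h3, h4⟩ := hS.exists_index_eq hn hx
    have hj : j = n - 1 := by
      by_contra hj
      have h3' : n = 3 := by omega
      have : j = 1 := by omega
      subst this
      exact hcon.1 h3' x (by simpa using h3)
    rw [h3, hj]
  obtain ⟨c, hc⟩ := this
  have := ncard_range_deg_le_of_const hn hc
  omega

end CommSystem

/-! ### Order `p ^ 4`: five values force constant index -/

theorem Set.eq_of_mem_of_ncard_eq_five {α : Type*} [LinearOrder α] {D : Set α}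
    (hD : D.ncard = 5) {a b c d e v : α} (ha : a ∈ D) (hb : b ∈ D) (hc : c ∈ D) (hd : d ∈ D)
    (he : e ∈ D) (hab : b < a) (hbc : c < b) (hcd : d < c) (hde : e < d) (hv : v ∈ D) :
    v = a ∨ v = b ∨ v = c ∨ v = d ∨ v = e := by
  have hsub : (({a, b, c, d, e} : Finset α) : Set α) ⊆ D := by
    intro x hx
    simp only [Finset.coe_insert, Finset.coe_singleton, Set.mem_insert_iff,
      Set.mem_singleton_iff] at hx
    rcases hx with rfl | rfl | rfl | rfl | rfl <;> assumption
  have hcard : ({a, b, c, d, e} : Finset α).card = 5 := by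
    have hac := hbc.trans hab
    have had := hcd.trans hac
    have hae := hde.trans had
    have hbd := hcd.trans hbc
    have hbe := hde.trans hbd
    have hce := hde.trans hcd
    simp [Finset.card_insert_of_notMem, hab.ne', hac.ne', had.ne', hae.ne', hbc.ne', hbd.ne',
      hbe.ne', hcd.ne', hce.ne', hde.ne']
  have := Set.eq_of_subset_of_ncard_le hsub (by rw [hD, Set.ncard_coe_finset, hcard])
    (Set.finite_of_ncard_ne_zero (by omega))
  rw [← this] at hv
  simpa using hv

theorem Subgroup.eq_zpowers_of_card_prime {Q : Type*} [Group Q] [Finite Q] {p : ℕ}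
    [Fact p.Prime] {Y : Subgroup Q} (hY : Nat.card Y = p) {y : Q} (hy : y ∈ Y) (hy1 : y ≠ 1) :
    Y = zpowers y := by
  have hp : p.Prime := Fact.out
  have hle : zpowers y ≤ Y := by rwa [zpowers_le]
  refine (eq_of_le_of_card_ge hle ?_).symm
  rcases (Nat.dvd_prime hp).1 (hY ▸ card_dvd_of_le hle) with h | h
  · rw [card_eq_one, zpowers_eq_bot] at h
    exact absurd h hy1
  · rw [h, hY]

theorem IsPGroup.exists_mem_zpowers_orderOf_eq {Q : Type*} [Group Q] [Finite Q] {p : ℕ}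
    [Fact p.Prime] (hQ : IsPGroup p Q) {x : Q} (hx : x ≠ 1) :
    ∃ y ∈ zpowers x, orderOf y = p := by
  obtain ⟨⟨y, hy⟩, hyp⟩ := exists_prime_orderOf_dvd_card' (G := zpowers x) p
    (by rw [Nat.card_zpowers]; exact hQ.dvd_orderOf hx)
  exact ⟨y, hy, by rwa [orderOf_mk] at hyp⟩

namespace CommSystem

variable {Q : Type*} [Group Q] {S : CommSystem Q} [Fintype Q] {p : ℕ} [Fact p.Prime]

theorem deg_of_card_prime {Y : Subgroup Q} (hY : Nat.card Y = p) {y : Q} (hy : y ∈ Y)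
    (hy1 : y ≠ 1) : S.deg Y = (1 + ((p : ℚ) - 1) * ((S.C y).index : ℚ)⁻¹) / p := by
  rw [S.deg_eq_of_const (c := (S.C y).index), hY]
  intro h hh hh1
  have h1 := eq_zpowers_of_card_prime hY hy hy1
  have h2 := eq_zpowers_of_card_prime hY hh hh1
  rw [le_antisymm (S.C_le_of_mem_zpowers (x := h) (y := y) (h2 ▸ hy))
    (S.C_le_of_mem_zpowers (x := y) (y := h) (h1 ▸ hh))]

/-- A subgroup of order `p ^ i` containing `C x` starts a strict step in any chain above it. -/
theorem exists_gt_deg_lt {n i : ℕ} (hn : Nat.card Q = p ^ n) (hi : i < n) {x : Q}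
    {H : Subgroup Q} (hx : S.C x ≤ H) (hH : Nat.card H = p ^ i) :
    ∃ K : Subgroup Q, S.C x ≤ K ∧ Nat.card K = p ^ (i + 1) ∧ S.deg K < S.deg H := by
  have hp : p.Prime := Fact.out
  obtain ⟨K, hK, hHK⟩ := Sylow.exists_subgroup_card_pow_prime_le p (G := Q) (n := i)
    (m := i + 1) (by rw [hn]; exact pow_dvd_pow p hi) H hH (Nat.le_succ i)
  refine ⟨K, hx.trans hHK, hK, S.deg_lt_deg_of_inf_C_le (lt_of_le_of_ne hHK ?_) x
    (inf_le_right.trans hx)⟩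
  rintro rfl
  exact absurd (Nat.pow_right_injective hp.two_le (hH.symm.trans hK)) (by simp)

/-- `C x` has order `p`, and a chain of five from `⊥` through it makes its degree the largest value
below 1. No subgroup of order `p` has larger degree, so none has smaller index. -/
theorem Faithful.index_eq_cube (hS : S.Faithful) (hn : Nat.card Q = p ^ 4)
    (h5 : (Set.range S.deg).ncard = 5) {x : Q} (hx : (S.C x).index = p ^ 3) {y : Q}
    (hy : y ≠ 1) : (S.C y).index = p ^ 3 := by
  have hp : p.Prime := Fact.out
  have hx1 : x ≠ 1 := by
    rintro rfl
    rw [C_one, index_top] at hx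
    exact (Nat.one_lt_pow (by norm_num) hp.one_lt).ne hx
  have hcard : Nat.card (S.C x) = p := by
    have h := (S.C x).card_mul_index
    rw [hx, hn, pow_succ' p 3] at h
    exact Nat.eq_of_mul_eq_mul_right (pow_pos hp.pos 3) h
  obtain ⟨K, hxK, hK, hlt1⟩ := exists_gt_deg_lt (i := 1) hn (by norm_num) le_rfl
    (by rw [hcard, pow_one])
  obtain ⟨M, hxM, hM, hlt2⟩ := exists_gt_deg_lt hn (by norm_num) hxK hK
  obtain ⟨T, hxT, hT, hlt3⟩ := exists_gt_deg_lt hn (by norm_num) hxM hM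
  obtain ⟨z, hzy, hz⟩ := (IsPGroup.of_card hn).exists_mem_zpowers_orderOf_eq hy
  have hz1 : z ≠ 1 := by
    rintro rfl
    rw [orderOf_one] at hz
    exact hp.one_lt.ne hz
  have hzc : Nat.card (zpowers z) = p := by rw [Nat.card_zpowers, hz]
  have hb : zpowers z ≠ ⊥ := by rwa [Ne, zpowers_eq_bot]
  have hCb : S.C x ≠ ⊥ := fun h => by
    rw [h, card_bot] at hcard
    exact hp.one_lt.ne hcard
  have hle : S.deg (zpowers z) ≤ S.deg (S.C x) := by
    have h1 := hS.deg_lt_one hb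
    rcases Set.eq_of_mem_of_ncard_eq_five h5 ⟨⊥, S.deg_bot⟩ ⟨_, rfl⟩ ⟨_, rfl⟩ ⟨_, rfl⟩
      ⟨_, rfl⟩ (hS.deg_lt_one hCb) hlt1 hlt2 hlt3 ⟨zpowers z, rfl⟩ with h | h | h | h | h <;>
      linarith
  -- For subgroups of order `p` the degree is a decreasing function of the index.
  rw [deg_of_card_prime hzc (mem_zpowers z) hz1, deg_of_card_prime hcard (S.self x) hx1,
    div_le_div_iff_of_pos_right (by exact_mod_cast hp.pos), add_le_add_iff_left,
    mul_le_mul_iff_right₀ (by rw [sub_pos]; exact_mod_cast hp.one_lt),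
    inv_le_inv₀ (by exact_mod_cast Nat.pos_of_ne_zero FiniteIndex.index_ne_zero)
      (by exact_mod_cast Nat.pos_of_ne_zero FiniteIndex.index_ne_zero), Nat.cast_le, hx] at hle
  obtain ⟨j, -, hj, hyj, -⟩ := hS.exists_index_eq hn hy
  have h2 := Nat.le_of_dvd (Nat.pos_of_ne_zero FiniteIndex.index_ne_zero)
    (index_dvd_of_le (S.C_le_of_mem_zpowers hzy))
  rw [hyj] at h2 ⊢
  exact le_antisymm (Nat.pow_le_pow_right hp.pos (by omega)) (hle.trans h2)

/-- `C` has index at least `p` away from the identity, so the degree of a subgroup containing an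
element of larger index is smaller than it would be for constant index `p`. -/
theorem Faithful.deg_lt_of_index_gt (hS : S.Faithful) {n : ℕ} (hn : Nat.card Q = p ^ n)
    {K : Subgroup Q} {x : Q} (hxK : x ∈ K) (hx : p < (S.C x).index) :
    S.deg K < (1 + ((Nat.card K : ℚ) - 1) * (p : ℚ)⁻¹) / Nat.card K := by
  classical
  have hp : p.Prime := Fact.out
  have hp0 : (0 : ℚ) < p := by exact_mod_cast hp.pos
  have hx1 : x ≠ 1 := by
    rintro rfl
    rw [C_one, index_top] at hx
    exact absurd hx (by have := hp.pos; omega)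
  have key : ∀ h : Q, (if h ∈ K then ((S.C h).index : ℚ)⁻¹ else 0) ≤
      (if h = 1 then 1 - (p : ℚ)⁻¹ else 0) + (p : ℚ)⁻¹ * (if h ∈ K then 1 else 0) := by
    intro h
    by_cases h1 : h = 1
    · subst h1
      simp [C_one, K.one_mem]
    · by_cases hK : h ∈ K
      · simp only [h1, hK, if_true, if_false, zero_add, mul_one]
        obtain ⟨j, hj, -, hij, -⟩ := hS.exists_index_eq hn h1
        refine inv_anti₀ hp0 ?_
        rw [hij]
        exact_mod_cast Nat.le_self_pow (by omega) p
      · simp [h1, hK]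
  have hsum : (∑ h : Q, ((if h = 1 then 1 - (p : ℚ)⁻¹ else 0) +
      (p : ℚ)⁻¹ * (if h ∈ K then 1 else 0))) = 1 + ((Nat.card K : ℚ) - 1) * (p : ℚ)⁻¹ := by
    rw [Finset.sum_add_distrib, ← Finset.mul_sum, sum_ite_mem_eq_card]
    simp
    ring
  rw [deg, ← hsum]
  refine div_lt_div_of_pos_right (Finset.sum_lt_sum (fun h _ => key h) ⟨x, Finset.mem_univ x, ?_⟩)
    (by exact_mod_cast Nat.card_pos)
  simp only [hx1, hxK, if_true, if_false, zero_add, mul_one]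
  exact inv_strictAnti₀ hp0 (by exact_mod_cast hx)

/-- If both indices occur, the number `u` falls into a gap of the chain through `C x`. But `u` is
the degree of a subgroup of order `p` with index `p ^ 2`, and of one of order `p ^ 2` with constant
index `p`. Excluding both leaves a single subgroup of order `p`; it lies in every nontrivial cyclic
subgroup, hence in every `C g` with `g ≠ 1`, against faithfulness. -/
theorem Faithful.index_ne_prime_of_index_eq_sq (hS : S.Faithful) (hn : Nat.card Q = p ^ 4)
    (h5 : (Set.range S.deg).ncard = 5) {x : Q} (hx : (S.C x).index = p ^ 2) (y : Q) :
    (S.C y).index ≠ p := by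
  intro hy
  have hp : p.Prime := Fact.out
  have hp1 : (1 : ℚ) < p := by exact_mod_cast hp.one_lt
  have hp0 : (0 : ℚ) < p := by linarith
  have hpp : p < p ^ 2 := by nlinarith [hp.one_lt]
  have hne1 : ∀ z : Q, orderOf z = p → z ≠ 1 := by
    rintro z hz rfl
    rw [orderOf_one] at hz
    exact hp.one_lt.ne hz
  have hcardz : ∀ z : Q, orderOf z = p → Nat.card (zpowers z) = p := fun z hz => by
    rw [Nat.card_zpowers, hz]
  have hcard : Nat.card (S.C x) = p ^ 2 := by
    have h := (S.C x).card_mul_index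
    rw [hx, hn, show p ^ 4 = p ^ 2 * p ^ 2 by ring] at h
    exact Nat.eq_of_mul_eq_mul_right (pow_pos hp.pos 2) h
  obtain ⟨M, hxM, hM, hlt2⟩ := exists_gt_deg_lt hn (by norm_num) le_rfl hcard
  obtain ⟨T, hxT, hT, hlt3⟩ := exists_gt_deg_lt hn (by norm_num) hxM hM
  obtain ⟨H, hHK, hH, hlt1⟩ := hS.exists_lt_deg_lt (i := 1) hcard
  rw [pow_one] at hH
  have hHb : H ≠ ⊥ := fun h => by
    rw [h, card_bot] at hH
    exact hp.one_lt.ne hH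
  have hD := fun L : Subgroup Q => Set.eq_of_mem_of_ncard_eq_five h5 ⟨⊥, S.deg_bot⟩ ⟨_, rfl⟩
    ⟨_, rfl⟩ ⟨_, rfl⟩ ⟨_, rfl⟩ (hS.deg_lt_one hHb) hlt1 hlt2 hlt3 ⟨L, rfl⟩
  set u : ℚ := (1 + ((p : ℚ) ^ 2 - 1) * (p : ℚ)⁻¹) / (p : ℚ) ^ 2 with hu
  have hKu : S.deg (S.C x) < u := by
    have := hS.deg_lt_of_index_gt hn (S.self x) (hx ▸ hpp)
    rw [hcard] at this
    push_cast at this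
    exact this
  have huH : u < S.deg H := by
    have hy1 : y ≠ 1 := by
      rintro rfl
      rw [C_one, index_top] at hy
      exact hp.one_lt.ne hy
    obtain ⟨z, hzy, hz⟩ := (IsPGroup.of_card hn).exists_mem_zpowers_orderOf_eq hy1
    have hzi : (S.C z).index = p := by
      rcases (Nat.dvd_prime hp).1 (hy ▸ index_dvd_of_le (S.C_le_of_mem_zpowers hzy)) with h | h
      · exact absurd (hS z (index_eq_one.1 h)) (hne1 z hz)
      · exact h
    have hzd := deg_of_card_prime (S := S) (hcardz z hz) (mem_zpowers z) (hne1 z hz)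
    have hzlt : S.deg (zpowers z) < 1 :=
      hS.deg_lt_one (by rw [Ne, zpowers_eq_bot]; exact hne1 z hz)
    have hle : S.deg (zpowers z) ≤ S.deg H := by
      rcases hD (zpowers z) with h | h | h | h | h <;> linarith
    refine lt_of_lt_of_le ?_ hle
    rw [hzd, hzi, hu, div_lt_div_iff₀ (by positivity) hp0]
    field_simp
    -- The gap is `(2p - 1)/p² - u = (p - 1)²/p³`.
    nlinarith [mul_pos hp0 (mul_pos (sub_pos.2 hp1) (sub_pos.2 hp1))]
  have hnu : ∀ L : Subgroup Q, S.deg L ≠ u := by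
    intro L hL
    have := hS.deg_lt_one hHb
    rcases hD L with h | h | h | h | h <;> linarith
  have hprime : ∀ z : Q, orderOf z = p → (S.C z).index = p := by
    intro z hz
    obtain ⟨j, hj1, hj4, hj, -⟩ := hS.exists_index_eq hn (hne1 z hz)
    obtain rfl | rfl | rfl : j = 1 ∨ j = 2 ∨ j = 3 := by omega
    · rw [hj, pow_one]
    · refine absurd ?_ (hnu (zpowers z))
      rw [deg_of_card_prime (hcardz z hz) (mem_zpowers z) (hne1 z hz), hj, hu]
      push_cast
      field_simp
      ring
    · have := hS.index_eq_cube hn h5 hj (y := y) (by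
        rintro rfl
        rw [C_one, index_top] at hy
        exact hp.one_lt.ne hy)
      rw [hy] at this
      have h3 : p ^ 1 = p ^ 3 := by rwa [pow_one]
      exact absurd (Nat.pow_right_injective hp.two_le h3) (by norm_num)
  have hQp : IsPGroup p Q := IsPGroup.of_card hn
  have : Nontrivial Q := ⟨x, 1, by
    rintro rfl
    rw [C_one, index_top] at hx
    exact (Nat.one_lt_pow (by norm_num) hp.one_lt).ne hx⟩
  have := hQp.center_nontrivial
  obtain ⟨⟨c, hc⟩, hc1⟩ := exists_ne (1 : center Q)
  obtain ⟨w, hwc, hw⟩ := hQp.exists_mem_zpowers_orderOf_eq (x := c)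
    (fun h => hc1 (Subtype.ext h))
  have hwZ : w ∈ center Q := (zpowers_le.2 hc) hwc
  -- Otherwise `⟨w⟩⟨z⟩`, with `w` central, is elementary abelian of order `p ^ 2`, and all its
  -- nontrivial elements have index `p`; its degree would be `u`.
  have hW : ∀ z : Q, orderOf z = p → z ∈ zpowers w := by
    intro z hz
    by_contra hzw
    have hcomm : ∀ g, Commute w g := fun g => (mem_center_iff.1 hwZ g).symm
    have hnorm : (zpowers w).Normal := ⟨fun a ha g => by
      obtain ⟨k, rfl⟩ := mem_zpowers_iff.1 ha
      have : g * w ^ k * g⁻¹ = w ^ k := by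
        rw [((hcomm g).zpow_left k).symm.eq, mul_inv_cancel_right]
      rw [this]; exact ha⟩
    have hsup : Nat.card (zpowers w ⊔ zpowers z : Subgroup Q) = p ^ 2 := by
      have hrel : (zpowers w).relIndex (zpowers z) = p := by
        have hdvd := (zpowers w).relIndex_dvd_card (zpowers z)
        rw [hcardz z hz] at hdvd
        rcases (Nat.dvd_prime hp).1 hdvd with h | h
        · exact absurd (relIndex_eq_one.1 h (mem_zpowers z)) hzw
        · exact h
      have h := relIndex_mul_relIndex ⊥ (zpowers w) (zpowers w ⊔ zpowers z) bot_le le_sup_left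
      rw [relIndex_bot_left, relIndex_bot_left, relIndex_sup_left, hrel, hcardz w hw] at h
      rw [← h, sq]
    refine hnu (zpowers w ⊔ zpowers z) ?_
    rw [S.deg_eq_of_const (c := p), hsup, hu]
    · push_cast; rfl
    intro h hh hh1
    obtain ⟨a, ha, b, hb, rfl⟩ := mem_sup_of_normal_left.1 hh
    refine hprime _ (orderOf_eq_prime ?_ hh1)
    obtain ⟨k, rfl⟩ := mem_zpowers_iff.1 ha
    obtain ⟨l, rfl⟩ := mem_zpowers_iff.1 hb
    rw [((hcomm _).zpow_left k).mul_pow, ← zpow_natCast, ← zpow_natCast, ← zpow_mul, ← zpow_mul,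
      mul_comm k, mul_comm l, zpow_mul, zpow_mul, zpow_natCast, zpow_natCast]
    nth_rewrite 1 [← hw]
    rw [← hz, pow_orderOf_eq_one, pow_orderOf_eq_one, one_zpow, one_zpow, one_mul]
  refine hne1 w hw (hS w (eq_top_iff.2 fun g _ => ?_))
  by_cases hg1 : g = 1
  · rw [hg1]; exact S.one_mem_C w
  obtain ⟨z, hzg, hz⟩ := hQp.exists_mem_zpowers_orderOf_eq hg1
  have hwz : w ∈ zpowers z := by
    rw [← eq_zpowers_of_card_prime (hcardz w hw) (hW z hz) (hne1 z hz)]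
    exact mem_zpowers w
  exact S.C_le_of_mem_zpowers ((zpowers_le.2 hzg) hwz) (S.self g)

theorem Faithful.exists_index_eq_of_ncard (hS : S.Faithful) (hn : Nat.card Q = p ^ 4)
    (h5 : (Set.range S.deg).ncard = 5) :
    ∃ m ∈ ({1, 2, 3} : Set ℕ), ∀ x : Q, x ≠ 1 → (S.C x).index = p ^ m := by
  by_cases h3 : ∃ x : Q, (S.C x).index = p ^ 3
  · obtain ⟨x, hx⟩ := h3
    exact ⟨3, by simp, fun y hy => hS.index_eq_cube hn h5 hx hy⟩
  push Not at h3
  by_cases h2 : ∃ x : Q, (S.C x).index = p ^ 2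
  · obtain ⟨x, hx⟩ := h2
    refine ⟨2, by simp, fun y hy => ?_⟩
    obtain ⟨j, hj1, hj4, hj, -⟩ := hS.exists_index_eq hn hy
    obtain rfl | rfl | rfl : j = 1 ∨ j = 2 ∨ j = 3 := by omega
    · exact absurd (by simpa using hj) (hS.index_ne_prime_of_index_eq_sq hn h5 hx y)
    · exact hj
    · exact absurd hj (h3 y)
  push Not at h2
  refine ⟨1, by simp, fun y hy => ?_⟩
  obtain ⟨j, hj1, hj4, hj, -⟩ := hS.exists_index_eq hn hy
  obtain rfl | rfl | rfl : j = 1 ∨ j = 2 ∨ j = 3 := by omega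
  · exact hj
  · exact absurd hj (h2 y)
  · exact absurd hj (h3 y)

end CommSystem

/-! ### Order `p ^ 3`: an abelian subgroup of index `p` -/

namespace CommSystem

variable {Q : Type*} [Group Q] {S : CommSystem Q} {p : ℕ} [Fact p.Prime]

/-- For `u` outside `⟨x⟩`, `C x ⊓ C u` contains both `x` and `u`, so its order exceeds `p` and it
fills `C x`, of order `p ^ 2`. -/
theorem C_le_C_of_index_eq_prime [Finite Q] (hn : Nat.card Q = p ^ 3)
    {x : Q} (hx : (S.C x).index = p) {u : Q} (hu : u ∈ S.C x) : S.C x ≤ S.C u := by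
  have hp : p.Prime := Fact.out
  by_cases hux : u ∈ zpowers x
  · exact S.C_le_of_mem_zpowers hux
  have hx1 : x ≠ 1 := by
    rintro rfl
    rw [C_one, index_top] at hx
    exact hp.one_lt.ne hx
  have hcard : Nat.card (S.C x) = p ^ 2 := by
    have h := (S.C x).card_mul_index
    rw [hx, hn, pow_succ] at h
    exact Nat.eq_of_mul_eq_mul_right hp.pos h
  set L := S.C x ⊓ S.C u with hL
  have hxL : zpowers x ≤ L := zpowers_le.2 ⟨S.self x, S.symm hu⟩
  have hlt : zpowers x < L := lt_of_le_of_ne hxL fun h => hux (h ▸ ⟨hu, S.self u⟩)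
  obtain ⟨i, hi, hLi⟩ := (Nat.dvd_prime_pow hp).1
    (hcard ▸ card_dvd_of_le (inf_le_left : L ≤ S.C x))
  have hi2 : i = 2 := by
    by_contra hne
    have : Nat.card L ∣ p := by
      rw [hLi]
      exact (pow_dvd_pow p (by omega : i ≤ 1)).trans (by rw [pow_one])
    rcases (Nat.dvd_prime hp).1 this with h | h
    · rw [card_eq_one.1 h] at hlt
      exact not_lt_bot hlt
    · exact hlt.ne' (eq_zpowers_of_card_prime h (hxL (mem_zpowers x)) hx1)
  have : L = S.C x := eq_of_le_of_card_ge inf_le_left (by rw [hLi, hcard, hi2])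
  rw [← this]
  exact inf_le_right

theorem Faithful.index_eq_prime_of_mem (hS : S.Faithful) [Finite Q] (hn : Nat.card Q = p ^ 3)
    {M : Subgroup Q} (hM : Nat.card M = p ^ 2) (hab : ∀ u ∈ M, M ≤ S.C u) {h : Q}
    (hh : h ∈ M) (hh1 : h ≠ 1) : (S.C h).index = p := by
  have hp : p.Prime := Fact.out
  obtain ⟨j, hj1, hj3, hj, hc⟩ := hS.exists_index_eq hn hh1
  have := (Nat.pow_dvd_pow_iff_le_right hp.one_lt).1 (hM ▸ hc ▸ card_dvd_of_le (hab h hh))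
  have : j = 1 := by omega
  rw [hj, this, pow_one]

theorem Faithful.index_eq_sq_of_notMem (hS : S.Faithful) [Finite Q] (hn : Nat.card Q = p ^ 3)
    {M : Subgroup Q} (hM : Nat.card M = p ^ 2) (hab : ∀ u ∈ M, M ≤ S.C u) {h : Q}
    (hh : h ∉ M) : (S.C h).index = p ^ 2 := by
  have hp : p.Prime := Fact.out
  have hMi : M.index = p := by
    have h := M.card_mul_index
    rw [hM, hn, pow_succ p 2] at h
    exact Nat.eq_of_mul_eq_mul_left (pow_pos hp.pos 2) h
  -- A nontrivial `u` here would have `C u = M`, since `M ≤ C u` and the indices agree; but `h ∈ C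
  -- u`.
  have hinf : S.C h ⊓ M = ⊥ := by
    rw [eq_bot_iff]
    rintro u ⟨huh, huM⟩
    rw [mem_bot]
    by_contra hu1
    have hi := hS.index_eq_prime_of_mem hn hM hab huM hu1
    have hmul := relIndex_mul_index (hab u huM)
    rw [hi, hMi] at hmul
    have := Nat.eq_of_mul_eq_mul_right hp.pos (hmul.trans (one_mul p).symm)
    exact hh (relIndex_eq_one.1 this (S.symm huh))
  have hle : Nat.card (S.C h) ≤ p := by
    have := natCard_inf_mul_relIndex (S.C h) M
    rw [hinf, card_bot, one_mul] at this
    rw [← this, ← hMi, ← relIndex_top_right]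
    exact relIndex_le_of_le_right le_top (relIndex_ne_zero_of_finite _ _)
  obtain ⟨j, hj1, hj3, hj, hc⟩ := hS.exists_index_eq hn (x := h) fun h1 => hh (h1 ▸ M.one_mem)
  rw [hc] at hle
  have := (Nat.pow_le_pow_iff_right hp.one_lt).1 (hle.trans (pow_one p).ge)
  have : j = 2 := by omega
  rw [hj, this]

variable [Fintype Q]

theorem Faithful.deg_eq_of_abelian (hS : S.Faithful) (hn : Nat.card Q = p ^ 3)
    {M : Subgroup Q} (hM : Nat.card M = p ^ 2) (hab : ∀ u ∈ M, M ≤ S.C u) (H : Subgroup Q) :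
    S.deg H = (1 + ((Nat.card (H ⊓ M : Subgroup Q) : ℚ) - 1) * (p : ℚ)⁻¹ +
      ((Nat.card H : ℚ) - Nat.card (H ⊓ M : Subgroup Q)) * ((p : ℚ) ^ 2)⁻¹) / Nat.card H := by
  classical
  rw [deg]
  congr 1
  have : ∀ h : Q, (if h ∈ H then ((S.C h).index : ℚ)⁻¹ else 0) =
      (if h = 1 then 1 - (p : ℚ)⁻¹ else 0) +
        (((p : ℚ)⁻¹ - ((p : ℚ) ^ 2)⁻¹) * (if h ∈ H ⊓ M then 1 else 0) +
          ((p : ℚ) ^ 2)⁻¹ * (if h ∈ H then 1 else 0)) := by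
    intro h
    by_cases h1 : h = 1
    · subst h1
      simp [C_one, one_mem]
    · by_cases hH : h ∈ H
      · by_cases hhM : h ∈ M
        · simp [h1, hH, hhM, hS.index_eq_prime_of_mem hn hM hab hhM h1]
        · simp [h1, hH, hhM, hS.index_eq_sq_of_notMem hn hM hab hhM]
      · simp [h1, hH]
  rw [Finset.sum_congr rfl fun h _ => this h, Finset.sum_add_distrib, Finset.sum_add_distrib,
    ← Finset.mul_sum, ← Finset.mul_sum, sum_ite_mem_eq_card, sum_ite_mem_eq_card]
  simp only [Finset.sum_ite_eq', Finset.mem_univ, if_true]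
  ring

theorem Faithful.range_deg_of_abelian (hS : S.Faithful) (hn : Nat.card Q = p ^ 3)
    {M : Subgroup Q} (hM : Nat.card M = p ^ 2) (hab : ∀ u ∈ M, M ≤ S.C u) :
    Set.range S.deg =
        {1, (2 * (p : ℚ) - 1) / (p : ℚ) ^ 2,
          ((p : ℚ) ^ 2 + (p : ℚ) - 1) / (p : ℚ) ^ 3,
          (3 * (p : ℚ) - 2) / (p : ℚ) ^ 3,
          (2 * (p : ℚ) ^ 2 - 1) / (p : ℚ) ^ 4} := by
  have hp : p.Prime := Fact.out
  have hp0 : (p : ℚ) ≠ 0 := by exact_mod_cast hp.ne_zero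
  have hdeg := hS.deg_eq_of_abelian hn hM hab
  have hMi : M.index = p := by
    have h := M.card_mul_index
    rw [hM, hn, pow_succ p 2] at h
    exact Nat.eq_of_mul_eq_mul_left (pow_pos hp.pos 2) h
  -- The degree depends only on `|H|` and `|H ⊓ M|`, which leaves six types of subgroup.
  have hcase : ∀ H : Subgroup Q, ∃ i, Nat.card H = p ^ i ∧
      (H ≤ M ∧ i ≤ 2 ∧ Nat.card (H ⊓ M : Subgroup Q) = p ^ i ∨
        1 ≤ i ∧ i ≤ 3 ∧ Nat.card (H ⊓ M : Subgroup Q) = p ^ (i - 1)) := by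
    intro H
    obtain ⟨i, hi, hHi⟩ := (Nat.dvd_prime_pow hp).1 (hn ▸ card_subgroup_dvd_card H)
    refine ⟨i, hHi, ?_⟩
    by_cases hHM : H ≤ M
    · left
      rw [inf_eq_left.2 hHM]
      have := card_dvd_of_le hHM
      rw [hHi, hM] at this
      exact ⟨hHM, (Nat.pow_dvd_pow_iff_le_right hp.one_lt).1 this, hHi⟩
    · right
      have hmul := natCard_inf_mul_relIndex H M
      rw [hHi] at hmul
      obtain ⟨k, hk, hki⟩ := (Nat.dvd_prime_pow hp).1 (Dvd.intro_left _ hmul)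
      have hle : M.relIndex H ≤ p := by
        rw [← hMi, ← relIndex_top_right]
        exact relIndex_le_of_le_right le_top (relIndex_ne_zero_of_finite _ _)
      rw [hki] at hle
      have hk1 := (Nat.pow_le_pow_iff_right hp.one_lt).1 (hle.trans (pow_one p).ge)
      have hk0 : k ≠ 0 := by
        rintro rfl
        exact hHM (relIndex_eq_one.1 (by simpa using hki))
      obtain rfl : k = 1 := by omega
      refine ⟨hk, hi, ?_⟩
      rw [hki, pow_one] at hmul
      refine Nat.eq_of_mul_eq_mul_right hp.pos ?_
      rw [hmul, ← pow_succ]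
      congr 1
      omega
  ext v
  simp only [Set.mem_range, Set.mem_insert_iff, Set.mem_singleton_iff]
  constructor
  · rintro ⟨H, rfl⟩
    obtain ⟨i, hHi, ⟨-, hi, hin⟩ | ⟨hi1, hi3, hin⟩⟩ := hcase H
    · rw [hdeg, hHi, hin]
      obtain rfl | rfl | rfl : i = 0 ∨ i = 1 ∨ i = 2 := by omega
      · left; simp
      · right; left; push_cast; field_simp; ring
      · right; right; left; push_cast; field_simp; ring
    · rw [hdeg, hHi, hin]
      obtain rfl | rfl | rfl : i = 1 ∨ i = 2 ∨ i = 3 := by omega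
      -- Subgroups of order `p` outside `M` have the same degree as `M`, so six types give five
      -- values.
      · right; right; left; push_cast; field_simp; ring
      · right; right; right; left; push_cast; field_simp; ring
      · right; right; right; right; push_cast; field_simp; ring
  · rintro (rfl | rfl | rfl | rfl | rfl)
    · exact ⟨⊥, S.deg_bot⟩
    · have hMb : (⊥ : Subgroup Q) < M := by
        refine bot_lt_iff_ne_bot.2 fun h => ?_
        rw [h, card_bot] at hM
        exact (Nat.one_lt_pow (by norm_num) hp.one_lt).ne hM
      obtain ⟨H, -, hHM, hH⟩ := exists_card_pow_between hMb hM
      refine ⟨H, ?_⟩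
      rw [hdeg, inf_eq_left.2 hHM.le, hH]
      push_cast; field_simp; ring
    · refine ⟨M, ?_⟩
      rw [hdeg, inf_idem, hM]
      push_cast; field_simp; ring
    · obtain ⟨x, hx⟩ : ∃ x, x ∉ M := by
        by_contra! h
        rw [(eq_top_iff' M).2 h, index_top] at hMi
        exact hp.one_lt.ne hMi
      have hxt : zpowers x < ⊤ := by
        refine lt_top_iff_ne_top.2 fun h => hx ?_
        have hC : zpowers x ≤ S.C x := zpowers_le.2 (S.self x)
        rw [h, top_le_iff] at hC
        rw [hS x hC]
        exact M.one_mem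
      obtain ⟨H, hxH, -, hH⟩ := exists_card_pow_between (i := 2) hxt (by rw [card_top, hn])
      obtain ⟨i, hHi, ⟨hHM, -⟩ | ⟨hi1, hi3, hin⟩⟩ := hcase H
      · exact absurd (hHM (hxH (mem_zpowers x))) hx
      · obtain rfl := Nat.pow_right_injective hp.two_le (hH.symm.trans hHi)
        refine ⟨H, ?_⟩
        rw [hdeg, hHi, hin]
        push_cast; field_simp; ring
    · refine ⟨⊤, ?_⟩
      rw [hdeg, top_inf_eq, hM, card_top, hn]
      push_cast; field_simp; ring

end CommSystem

/-! ### Passing from `G` to `G ⧸ center G` -/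

section Bridge

variable (G : Type*) [Group G]

/-- The commuting relation of a group. -/
def centralizerSystem : CommSystem G where
  C g := centralizer {g}
  symm h := by
    rw [mem_centralizer_singleton_iff] at *
    exact h.symm
  self x := by rw [mem_centralizer_singleton_iff]

variable {G}

/-- Central factors do not affect commuting, so the choice of representatives is immaterial. -/
theorem mem_centralizer_singleton_iff_of_mk_eq {a b c d : G}
    (hac : (a : G ⧸ center G) = c) (hbd : (b : G ⧸ center G) = d)
    (h : a ∈ centralizer {b}) : c ∈ centralizer {d} := by
  rw [QuotientGroup.eq] at hac hbd
  rw [mem_centralizer_singleton_iff] at *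
  have hc : c = a * (a⁻¹ * c) := by group
  have hd : d = b * (b⁻¹ * d) := by group
  have h1 : Commute (a⁻¹ * c) d := (mem_center_iff.1 hac d).symm
  have h2 : Commute (b⁻¹ * d) a := (mem_center_iff.1 hbd a).symm
  have h3 : Commute a d := by
    rw [hd]
    exact Commute.mul_right h h2.symm
  have h4 : Commute c d := by
    rw [hc]
    exact h3.mul_left h1
  exact h4

variable (G) in
/-- The relation on `G ⧸ center G` that representatives commute. -/
noncomputable def centerQuotientSystem : CommSystem (G ⧸ center G) where
  C q := (centralizer {q.out}).map (QuotientGroup.mk' (center G))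
  symm := by
    rintro x y ⟨a, ha, rfl⟩
    refine ⟨y.out, ?_, QuotientGroup.out_eq' y⟩
    refine mem_centralizer_singleton_iff_of_mk_eq (a := y.out) (b := a) rfl ?_ ?_
    · exact (QuotientGroup.out_eq' _).symm
    · exact (centralizerSystem G).symm ha
  self x := ⟨x.out, (centralizerSystem G).self _, QuotientGroup.out_eq' x⟩

theorem comap_centerQuotientSystem_C (g : G) :
    ((centerQuotientSystem G).C (g : G ⧸ center G)).comap (QuotientGroup.mk' (center G)) =
      centralizer {g} := by
  ext x
  rw [mem_comap]
  constructor
  · rintro ⟨a, ha, hax⟩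
    exact mem_centralizer_singleton_iff_of_mk_eq hax (QuotientGroup.out_eq' _) ha
  · intro hx
    exact ⟨x, mem_centralizer_singleton_iff_of_mk_eq rfl (QuotientGroup.out_eq' _).symm hx, rfl⟩

theorem index_centerQuotientSystem_C (g : G) :
    ((centerQuotientSystem G).C (g : G ⧸ center G)).index = (centralizer {g}).index := by
  rw [← comap_centerQuotientSystem_C,
    index_comap_of_surjective _ (QuotientGroup.mk'_surjective _)]

theorem faithful_centerQuotientSystem : (centerQuotientSystem G).Faithful := by
  intro x hx
  obtain ⟨g, rfl⟩ := QuotientGroup.mk_surjective x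
  have h := comap_centerQuotientSystem_C g
  rw [hx, comap_top] at h
  refine (QuotientGroup.eq_one_iff g).2 (mem_center_iff.2 fun a => ?_)
  have : a ∈ centralizer {g} := h ▸ mem_top a
  exact mem_centralizer_singleton_iff.1 this

theorem ncard_carrier_mk (g : G) :
    (ConjClasses.mk g).carrier.ncard = (centralizer {g}).index := by
  rw [← ConjAct.orbit_eq_carrier_conjClasses, ← MulAction.index_stabilizer,
    centralizer_eq_comap_stabilizer]
  exact (index_comap_of_surjective (f := ConjAct.toConjAct.toMonoidHom (M := G)) _
    ConjAct.toConjAct.surjective).symm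

theorem conjClassSizes_eq_range :
    conjClassSizes G = Set.range fun x : G ⧸ center G => ((centerQuotientSystem G).C x).index := by
  ext n
  constructor
  · rintro ⟨c, rfl⟩
    obtain ⟨g, rfl⟩ := ConjClasses.mk_surjective c
    exact ⟨g, (index_centerQuotientSystem_C g).trans (ncard_carrier_mk g).symm⟩
  · rintro ⟨x, rfl⟩
    obtain ⟨g, rfl⟩ := QuotientGroup.mk_surjective x
    exact ⟨ConjClasses.mk g, (ncard_carrier_mk g).trans (index_centerQuotientSystem_C g).symm⟩

theorem sum_comp_quotientMk [Fintype G] (N : Subgroup G) [Fintype (G ⧸ N)] (f : G ⧸ N → ℚ) :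
    ∑ g : G, f g = Nat.card N * ∑ q : G ⧸ N, f q := by
  have : Fintype N := Fintype.ofFinite _
  have hmk : ∀ (q : G ⧸ N) (z : N), ((q.out * z : G) : G ⧸ N) = q := fun q z => by
    rw [QuotientGroup.mk_mul_of_mem _ z.2, QuotientGroup.out_eq']
  have hbij : Function.Bijective fun x : (G ⧸ N) × N => (x.1.out * x.2 : G) := by
    constructor
    · rintro ⟨q, z⟩ ⟨q', z'⟩ h
      have hq : q = q' := by rw [← hmk q z, ← hmk q' z']; exact congrArg _ h
      subst hq
      exact Prod.ext rfl (Subtype.ext (mul_left_cancel h))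
    · intro g
      refine ⟨((g : G ⧸ N), ⟨(g : G ⧸ N).out⁻¹ * g, ?_⟩), mul_inv_cancel_left _ _⟩
      rw [← QuotientGroup.eq, QuotientGroup.out_eq']
  rw [← Fintype.sum_bijective _ hbij (fun x => f x.1) (fun g => f g)
    fun x => by rw [hmk], Fintype.sum_prod_type, Finset.mul_sum]
  simp

variable [Fintype G]

theorem relCommDegree_eq_deg (H : Subgroup G) :
    relCommDegree H = (centralizerSystem G).deg H := by
  classical
  have hcard : Nat.card {x : H × G // (x.1 : G) * x.2 = x.2 * (x.1 : G)} =
      ∑ h : H, Nat.card (centralizer {(h : G)}) := by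
    rw [← Nat.card_sigma]
    refine Nat.card_congr
      { toFun := fun x => ⟨x.1.1, x.1.2, mem_centralizer_singleton_iff.2 x.2.symm⟩
        invFun := fun x => ⟨(x.1, x.2.1), (mem_centralizer_singleton_iff.1 x.2.2).symm⟩
        left_inv := fun _ => rfl
        right_inv := fun _ => rfl }
  have hG : (Nat.card G : ℚ) ≠ 0 := by exact_mod_cast Nat.card_pos.ne'
  have hterm : ∀ h : G, (Nat.card (centralizer {h}) : ℚ) =
      ((centralizer {h}).index : ℚ)⁻¹ * Nat.card G := by
    intro h
    have h0 : ((centralizer {h}).index : ℚ) ≠ 0 := by exact_mod_cast FiniteIndex.index_ne_zero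
    rw [← (centralizer {h}).card_mul_index]
    push_cast
    field_simp
  rw [relCommDegree, hcard, CommSystem.deg, ← Finset.sum_filter,
    Finset.sum_subtype (p := fun h => h ∈ H) _ (by simp)]
  push_cast
  rw [Finset.sum_congr rfl fun (h : H) _ => hterm h, ← Finset.sum_mul, mul_div_mul_right _ _ hG]
  rfl

variable [Fintype (G ⧸ center G)]

/-- In the average over `g`, each relative index depends only on the coset of `g`, and all cosets
have `|Z(G)|` elements. -/
theorem deg_map_mk (H : Subgroup G) :
    (centerQuotientSystem G).deg (H.map (QuotientGroup.mk' (center G))) =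
      (centralizerSystem G).deg H := by
  have hZ : (Nat.card (center G) : ℚ) ≠ 0 := by exact_mod_cast Nat.card_pos.ne'
  have hQ : (Nat.card (G ⧸ center G) : ℚ) ≠ 0 := by exact_mod_cast Nat.card_pos.ne'
  rw [CommSystem.deg_eq_sum_relIndex, CommSystem.deg_eq_sum_relIndex]
  have h1 : ∀ g : G, ((((centralizerSystem G).C g).relIndex H : ℕ) : ℚ)⁻¹ =
      (((centerQuotientSystem G).C (g : G ⧸ center G)).relIndex
        (H.map (QuotientGroup.mk' (center G))) : ℚ)⁻¹ := by
    intro g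
    rw [← relIndex_comap, comap_centerQuotientSystem_C]
    rfl
  rw [Finset.sum_congr rfl fun g _ => h1 g, sum_comp_quotientMk (center G) fun q =>
      (((centerQuotientSystem G).C q).relIndex (H.map (QuotientGroup.mk' (center G))) : ℚ)⁻¹,
    Subgroup.card_eq_card_quotient_mul_card_subgroup (center G)]
  push_cast
  field_simp

theorem relCommDegrees_eq_range_deg :
    relCommDegrees G = Set.range (centerQuotientSystem G).deg := by
  ext v
  constructor
  · rintro ⟨H, rfl⟩
    exact ⟨_, (deg_map_mk H).trans (relCommDegree_eq_deg H).symm⟩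
  · rintro ⟨H, rfl⟩
    refine ⟨H.comap (QuotientGroup.mk' (center G)), ?_⟩
    change relCommDegree _ = _
    rw [relCommDegree_eq_deg, ← deg_map_mk,
      map_comap_eq_self_of_surjective (QuotientGroup.mk'_surjective _)]

end Bridge

/-! ### Nilpotent groups: only one prime divides the order of the central quotient -/

section Nilpotent

variable {G : Type*} [Group G] [Finite G] [Group.IsNilpotent G]

theorem Sylow.commute_of_ne {p q : ℕ} [Fact p.Prime] [Fact q.Prime] (hpq : p ≠ q)
    (P : Sylow p G) (R : Sylow q G) {a b : G} (ha : a ∈ P) (hb : b ∈ R) : Commute a b :=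
  commute_of_normal_of_disjoint (P : Subgroup G) (R : Subgroup G) inferInstance inferInstance
    (IsPGroup.disjoint_of_ne p q hpq _ _ P.isPGroup' R.isPGroup') a b ha hb

/-- The centralizer of an element of a Sylow `p`-subgroup has `p`-power index. -/
theorem Sylow.exists_index_centralizer_eq_pow {p : ℕ} [Fact p.Prime] (P : Sylow p G) {a : G}
    (ha : a ∈ P) : ∃ k, (centralizer {a}).index = p ^ k := by
  refine ⟨_, Nat.eq_prime_pow_of_unique_prime_dvd FiniteIndex.index_ne_zero ?_⟩
  intro q hq hdvd
  by_contra hne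
  have : Fact q.Prime := ⟨hq⟩
  obtain ⟨R⟩ : Nonempty (Sylow q G) := inferInstance
  have hle : (R : Subgroup G) ≤ centralizer {a} := fun b hb =>
    mem_centralizer_singleton_iff.2 (Sylow.commute_of_ne hne R P hb ha)
  exact R.not_dvd_index (hdvd.trans (index_dvd_of_le hle))

/-- An element of `P` centralizing `P` has class size both a power of `p` and prime to `p`, so it is
central; and `P` cannot be central. -/
theorem Sylow.exists_not_commute {p : ℕ} [hp : Fact p.Prime] (P : Sylow p G)
    (h : p ∣ Nat.card (G ⧸ center G)) :
    ∃ a ∈ P, ∃ b ∈ P, ¬ a * b = b * a := by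
  have hnle : ¬ (P : Subgroup G) ≤ center G := fun hle =>
    P.not_dvd_index (h.trans (index_dvd_of_le hle))
  obtain ⟨a, ha, haZ⟩ := SetLike.not_le_iff_exists.1 hnle
  refine ⟨a, ha, ?_⟩
  by_contra! hcon
  obtain ⟨k, hk⟩ := P.exists_index_centralizer_eq_pow ha
  have hle : (P : Subgroup G) ≤ centralizer {a} := fun b hb =>
    mem_centralizer_singleton_iff.2 (hcon b hb).symm
  have hk0 : k = 0 := by
    by_contra hk0
    exact P.not_dvd_index (((dvd_pow_self p hk0).trans hk.symm.dvd).trans (index_dvd_of_le hle))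
  rw [hk0, pow_zero, index_eq_one] at hk
  refine haZ (mem_center_iff.2 fun g => ?_)
  exact mem_centralizer_singleton_iff.1 (hk ▸ mem_top g)

theorem Sylow.exists_deg_mul_pow_eq [Fintype G] {p : ℕ} [hp : Fact p.Prime] (P : Sylow p G)
    {H : Subgroup G} (hH : H ≤ P) :
    ∃ k N : ℕ, (centralizerSystem G).deg H * (p : ℚ) ^ k = N := by
  classical
  have hp0 : (p : ℚ) ≠ 0 := by exact_mod_cast hp.out.ne_zero
  obtain ⟨l, hl⟩ := IsPGroup.iff_card.1 (P.isPGroup'.to_le hH)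
  obtain ⟨k, hk⟩ : ∃ k, ∀ h ∈ H, ∃ j ≤ k, (centralizer {h}).index = p ^ j := by
    refine ⟨Nat.card G, fun h hh => ?_⟩
    obtain ⟨j, hj⟩ := P.exists_index_centralizer_eq_pow (hH hh)
    refine ⟨j, ?_, hj⟩
    have : p ^ j ≤ Nat.card G := hj ▸ Nat.le_of_dvd Nat.card_pos (index_dvd_card _)
    exact (Nat.lt_pow_self hp.out.one_lt).le.trans this
  choose! j hjk hj using hk
  refine ⟨l + k, ∑ h : G, if h ∈ H then p ^ (k - j h) else 0, ?_⟩
  rw [CommSystem.deg, hl]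
  push_cast
  rw [div_mul_eq_mul_div, pow_add, mul_comm ((p : ℚ) ^ l), ← mul_assoc,
    mul_div_assoc, div_self (pow_ne_zero l hp0), mul_one, Finset.sum_mul]
  refine Finset.sum_congr rfl fun h _ => ?_
  split_ifs with hh
  · change (((centralizer {h}).index : ℕ) : ℚ)⁻¹ * _ = _
    rw [hj h hh, pow_sub₀ _ hp0 (hjk h hh)]
    push_cast
    ring
  · simp

/-- The five values along `⊥ < ⟨a⟩ < P < P⟨b⟩ < PR` are strictly decreasing. -/
theorem Sylow.deg_chain [Fintype G] {p q : ℕ} [Fact p.Prime] [Fact q.Prime] (hpq : p ≠ q)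
    (P : Sylow p G) (R : Sylow q G) {a a' b b' : G} (ha : a ∈ P) (ha' : a' ∈ P)
    (haa : ¬ a * a' = a' * a) (hb : b ∈ R) (hb' : b' ∈ R) (hbb : ¬ b * b' = b' * b) :
    (centralizerSystem G).deg (zpowers a) < 1 ∧
    (centralizerSystem G).deg P < (centralizerSystem G).deg (zpowers a) ∧
    (centralizerSystem G).deg (P ⊔ zpowers b) < (centralizerSystem G).deg P ∧
    (centralizerSystem G).deg (P ⊔ R) < (centralizerSystem G).deg (P ⊔ zpowers b) := by
  set S := centralizerSystem G
  have hmem : ∀ x y : G, x ∈ S.C y ↔ x * y = y * x := fun x y => mem_centralizer_singleton_iff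
  have hPC : ∀ y ∈ R, (P : Subgroup G) ≤ S.C y := fun y hy x hx =>
    (hmem x y).2 (Sylow.commute_of_ne hpq P R hx hy)
  refine ⟨?_, ?_, ?_, ?_⟩
  · rw [← S.deg_bot]
    exact S.deg_lt_deg_of_le_C bot_le a' bot_le
      fun h => haa ((hmem _ _).1 (h (mem_zpowers a)))
  · exact S.deg_lt_deg_of_le_C (zpowers_le.2 ha) a (zpowers_le.2 (S.self a))
      fun h => haa ((hmem _ _).1 (h ha')).symm
  · exact S.deg_lt_deg_of_le_C le_sup_left b' (hPC b' hb')
      fun h => hbb ((hmem _ _).1 (h (mem_sup_right (mem_zpowers b))))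
  · exact S.deg_lt_deg_of_le_C (sup_le_sup_left (zpowers_le.2 hb) _) b
      (sup_le (hPC b hb) (zpowers_le.2 (S.self b)))
      fun h => hbb ((hmem _ _).1 (h (mem_sup_right hb'))).symm

theorem eq_of_prime_dvd_card_quotient_center (h5 : (relCommDegrees G).ncard = 5) {p q : ℕ}
    (hp : p.Prime) (hq : q.Prime) (hpZ : p ∣ Nat.card (G ⧸ center G))
    (hqZ : q ∣ Nat.card (G ⧸ center G)) : p = q := by
  by_contra hpq
  have := Fintype.ofFinite G
  have : Fact p.Prime := ⟨hp⟩
  have : Fact q.Prime := ⟨hq⟩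
  obtain ⟨P⟩ : Nonempty (Sylow p G) := inferInstance
  obtain ⟨R⟩ : Nonempty (Sylow q G) := inferInstance
  obtain ⟨a, ha, a', ha', haa⟩ := P.exists_not_commute hpZ
  obtain ⟨b, hb, b', hb', hbb⟩ := R.exists_not_commute hqZ
  obtain ⟨h1, h2, h3, h4⟩ := Sylow.deg_chain hpq P R ha ha' haa hb hb' hbb
  obtain ⟨k1, k2, k3, k4⟩ := Sylow.deg_chain (Ne.symm hpq) R P hb hb' hbb ha ha' haa
  have hrange : ∀ H : Subgroup G, (centralizerSystem G).deg H ∈ relCommDegrees G :=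
    fun H => ⟨H, relCommDegree_eq_deg H⟩
  have h0 : (1 : ℚ) ∈ relCommDegrees G := (centralizerSystem G).deg_bot ▸ hrange ⊥
  have hP := Set.eq_of_mem_of_ncard_eq_five h5 h0 (hrange _) (hrange _) (hrange _) (hrange _)
    h1 h2 h3 h4 (hrange (zpowers b))
  have hR := Set.eq_of_mem_of_ncard_eq_five h5 h0 (hrange _) (hrange _) (hrange _) (hrange _)
    k1 k2 k3 k4 (hrange (zpowers a))
  have heq : (centralizerSystem G).deg (zpowers a) = (centralizerSystem G).deg (zpowers b) := by
    apply le_antisymm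
    · rcases hR with h | h | h | h | h <;> linarith
    · rcases hP with h | h | h | h | h <;> linarith
  have hpos := (centralizerSystem G).deg_pos (zpowers a)
  obtain ⟨k, N, hN⟩ := P.exists_deg_mul_pow_eq (zpowers_le.2 ha)
  obtain ⟨l, N', hN'⟩ := R.exists_deg_mul_pow_eq (zpowers_le.2 hb)
  rw [← heq] at hN'
  set d := (centralizerSystem G).deg (zpowers a)
  have hmul : N * q ^ l = N' * p ^ k := by
    have : (N : ℚ) * (q : ℚ) ^ l = N' * (p : ℚ) ^ k := by
      rw [← hN, ← hN']; ring
    exact_mod_cast this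
  have hcop : Nat.Coprime (p ^ k) (q ^ l) :=
    Nat.Coprime.pow k l ((Nat.coprime_primes hp hq).2 hpq)
  -- Coprimality of the two denominators makes the common degree an integer, yet it lies strictly
  -- between 0 and 1.
  obtain ⟨c, rfl⟩ := hcop.dvd_of_dvd_mul_right (Dvd.intro_left _ hmul.symm)
  have hpk : (0 : ℚ) < (p : ℚ) ^ k := pow_pos (by exact_mod_cast hp.pos) k
  have hd : d = c := by
    push_cast at hN
    rw [mul_comm] at hN
    exact mul_left_cancel₀ hpk.ne' hN
  rw [hd] at hpos h1
  have e1 : 0 < c := by exact_mod_cast hpos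
  have e2 : c < 1 := by exact_mod_cast h1
  omega

end Nilpotent

/-! ### The two cases and their values -/

section Main

variable {G : Type*} [Group G] {p : ℕ}

theorem FourthPowerCase.index_eq {m : ℕ} (h : FourthPowerCase G p m) (x : G ⧸ center G)
    (hx : x ≠ 1) : ((centerQuotientSystem G).C x).index = p ^ m := by
  have hmem : ((centerQuotientSystem G).C x).index ∈ conjClassSizes G := by
    rw [conjClassSizes_eq_range]
    exact ⟨x, rfl⟩
  rw [h.2.2] at hmem
  rcases hmem with h | h
  · exact absurd (faithful_centerQuotientSystem x (index_eq_one.1 h)) hx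
  · exact h

variable [Finite G]

theorem CubeCase.exists_abelian [Fact p.Prime] (h : CubeCase G p) :
    ∃ M : Subgroup (G ⧸ center G), Nat.card M = p ^ 2 ∧
      ∀ u ∈ M, M ≤ (centerQuotientSystem G).C u := by
  have hp : p.Prime := Fact.out
  obtain ⟨hn, M, hM, hab⟩ := h
  set π := QuotientGroup.mk' (center G)
  have hπ : Function.Surjective π := QuotientGroup.mk'_surjective _
  have hMab : ∀ u ∈ M.map π, M.map π ≤ (centerQuotientSystem G).C u := by
    rintro _ ⟨u, hu, rfl⟩ _ ⟨v, hv, rfl⟩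
    have : v ∈ centralizer {u} := mem_centralizer_singleton_iff.2 (hab v hv u hu)
    rwa [← comap_centerQuotientSystem_C] at this
  have hlt : M.map π < ⊤ := by
    refine lt_top_iff_ne_top.2 fun htop => ?_
    have hall : ∀ x : G ⧸ center G, x = 1 := fun x =>
      faithful_centerQuotientSystem x (top_le_iff.1 (htop ▸ hMab x (htop ▸ mem_top x)))
    have : Subsingleton (G ⧸ center G) := ⟨fun x y => (hall x).trans (hall y).symm⟩
    rw [Nat.card_of_subsingleton (1 : G ⧸ center G)] at hn
    exact (Nat.one_lt_pow (by norm_num) hp.one_lt).ne hn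
  -- The image of `M` is proper; the preimage of an order `p ^ 2` subgroup above it is proper and
  -- contains `M`, so maximality gives equality.
  obtain ⟨H, hMH, hH, hHc⟩ := exists_card_pow_between (i := 2) hlt (by rw [card_top, hn])
  have hMK : M ≤ H.comap π := map_le_iff_le_comap.1 hMH
  have heq : H.comap π = M := by
    by_contra hne
    have htop := hM.2 _ (lt_of_le_of_ne hMK (Ne.symm hne))
    refine hH.ne ?_
    rw [← map_comap_eq_self_of_surjective hπ H, htop, map_top_of_surjective π hπ]
  refine ⟨M.map π, ?_, hMab⟩
  rw [← heq, map_comap_eq_self_of_surjective hπ, hHc]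

theorem cubeCase_of_index_eq [Fact p.Prime] (hn : Nat.card (G ⧸ center G) = p ^ 3)
    {x : G ⧸ center G} (hx : ((centerQuotientSystem G).C x).index = p) : CubeCase G p := by
  have hp : p.Prime := Fact.out
  obtain ⟨g, rfl⟩ := QuotientGroup.mk_surjective x
  have hidx : (centralizer {g}).index = p := by rw [← index_centerQuotientSystem_C, hx]
  refine ⟨hn, centralizer {g}, ⟨?_, ?_⟩, ?_⟩
  · intro htop
    rw [htop, index_top] at hidx
    exact hp.one_lt.ne hidx
  · intro K hK
    have hmul := relIndex_mul_index hK.le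
    rw [hidx] at hmul
    rcases (Nat.dvd_prime hp).1 (Dvd.intro_left _ hmul) with h | h
    · exact index_eq_one.1 h
    · rw [h] at hmul
      have := Nat.eq_of_mul_eq_mul_right hp.pos (hmul.trans (one_mul p).symm)
      exact absurd (relIndex_eq_one.1 this) hK.not_ge
  · intro u hu v hv
    rw [← comap_centerQuotientSystem_C] at hu hv
    have := CommSystem.C_le_C_of_index_eq_prime hn hx hv hu
    have : u ∈ centralizer {v} := by
      rw [← comap_centerQuotientSystem_C]
      exact this
    exact mem_centralizer_singleton_iff.1 this

theorem fourthPowerCase_of_index_eq [Fact p.Prime] {m : ℕ} (hm : m ∈ ({1, 2, 3} : Set ℕ))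
    (hn : Nat.card (G ⧸ center G) = p ^ 4)
    (h : ∀ x : G ⧸ center G, x ≠ 1 → ((centerQuotientSystem G).C x).index = p ^ m) :
    FourthPowerCase G p m := by
  have hp : p.Prime := Fact.out
  refine ⟨hn, hm, ?_⟩
  rw [conjClassSizes_eq_range]
  have : Nontrivial (G ⧸ center G) := by
    rw [← Finite.one_lt_card_iff_nontrivial, hn]
    exact Nat.one_lt_pow (by norm_num) hp.one_lt
  obtain ⟨y, hy⟩ := exists_ne (1 : G ⧸ center G)
  ext k
  constructor
  · rintro ⟨x, rfl⟩
    by_cases hx : x = 1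
    · left
      simp [hx, CommSystem.C_one]
    · right
      exact h x hx
  · rintro (rfl | rfl)
    · exact ⟨1, by simp [CommSystem.C_one]⟩
    · exact ⟨y, h y hy⟩

theorem CubeCase.relCommDegrees_eq [Fact p.Prime] (h : CubeCase G p) :
    relCommDegrees G =
        {1, (2 * (p : ℚ) - 1) / (p : ℚ) ^ 2,
          ((p : ℚ) ^ 2 + (p : ℚ) - 1) / (p : ℚ) ^ 3,
          (3 * (p : ℚ) - 2) / (p : ℚ) ^ 3,
          (2 * (p : ℚ) ^ 2 - 1) / (p : ℚ) ^ 4} := by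
  have := Fintype.ofFinite G
  have := Fintype.ofFinite (G ⧸ center G)
  obtain ⟨M, hM, hab⟩ := h.exists_abelian
  rw [relCommDegrees_eq_range_deg]
  exact faithful_centerQuotientSystem.range_deg_of_abelian h.1 hM hab

theorem FourthPowerCase.relCommDegrees_eq [Fact p.Prime] {m : ℕ} (h : FourthPowerCase G p m) :
    relCommDegrees G =
        {1, ((p : ℚ) ^ m + (p : ℚ) - 1) / (p : ℚ) ^ (m + 1),
          ((p : ℚ) ^ m + (p : ℚ) ^ 2 - 1) / (p : ℚ) ^ (m + 2),
          ((p : ℚ) ^ m + (p : ℚ) ^ 3 - 1) / (p : ℚ) ^ (m + 3),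
          ((p : ℚ) ^ m + (p : ℚ) ^ 4 - 1) / (p : ℚ) ^ (m + 4)} := by
  have hp : p.Prime := Fact.out
  have hp0 : (p : ℚ) ≠ 0 := by exact_mod_cast hp.ne_zero
  have := Fintype.ofFinite G
  have := Fintype.ofFinite (G ⧸ center G)
  rw [relCommDegrees_eq_range_deg, CommSystem.range_deg_eq_of_const h.1 h.index_eq]
  have hterm : ∀ i : ℕ, (1 + ((p : ℚ) ^ i - 1) * ((p ^ m : ℕ) : ℚ)⁻¹) / (p : ℚ) ^ i =
      ((p : ℚ) ^ m + (p : ℚ) ^ i - 1) / (p : ℚ) ^ (m + i) := by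
    intro i
    rw [pow_add]
    push_cast
    field_simp
    ring
  have hIio : Set.Iio (4 + 1) = ({0, 1, 2, 3, 4} : Set ℕ) := by
    ext i
    simp only [Set.mem_Iio, Set.mem_insert_iff, Set.mem_singleton_iff]
    omega
  simp only [hterm, hIio, Set.image_insert_eq, Set.image_singleton, pow_zero, pow_one, add_zero,
    add_sub_cancel_right, div_self (pow_ne_zero m hp0)]

theorem Set.ncard_eq_five_of_lt {a b c d e : ℚ} (hab : b < a) (hbc : c < b) (hcd : d < c)
    (hde : e < d) : ({a, b, c, d, e} : Set ℚ).ncard = 5 := by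
  have hac := hbc.trans hab
  have had := hcd.trans hac
  have hae := hde.trans had
  have hbd := hcd.trans hbc
  have hbe := hde.trans hbd
  have hce := hde.trans hcd
  rw [Set.ncard_insert_of_notMem, Set.ncard_insert_of_notMem, Set.ncard_insert_of_notMem,
    Set.ncard_pair hde.ne']
  · simp [hcd.ne', hce.ne']
  · simp [hbc.ne', hbd.ne', hbe.ne']
  · simp [hab.ne', hac.ne', had.ne', hae.ne']

theorem CubeCase.ncard_relCommDegrees [Fact p.Prime] (h : CubeCase G p) :
    (relCommDegrees G).ncard = 5 := by
  have hp : p.Prime := Fact.out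
  have hp1 : (1 : ℚ) < p := by exact_mod_cast hp.one_lt
  have hp0 : (0 : ℚ) < p := by linarith
  -- All four gaps between consecutive values are `(p - 1)²` over a power of `p`.
  have hsq : 0 < ((p : ℚ) - 1) ^ 2 := pow_pos (by linarith) 2
  rw [h.relCommDegrees_eq]
  refine Set.ncard_eq_five_of_lt ?_ ?_ ?_ ?_
  · rw [div_lt_one (by positivity)]
    nlinarith
  · rw [div_lt_div_iff₀ (by positivity) (by positivity), ← sub_pos]
    have : (2 * (p : ℚ) - 1) * (p : ℚ) ^ 3 - ((p : ℚ) ^ 2 + p - 1) * (p : ℚ) ^ 2 =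
      (p : ℚ) ^ 2 * ((p : ℚ) - 1) ^ 2 := by ring
    rw [this]
    positivity
  · refine div_lt_div_of_pos_right ?_ (by positivity)
    nlinarith
  · rw [div_lt_div_iff₀ (by positivity) (by positivity), ← sub_pos]
    have : (3 * (p : ℚ) - 2) * (p : ℚ) ^ 4 - (2 * (p : ℚ) ^ 2 - 1) * (p : ℚ) ^ 3 =
      (p : ℚ) ^ 3 * ((p : ℚ) - 1) ^ 2 := by ring
    rw [this]
    positivity

theorem FourthPowerCase.ncard_relCommDegrees [Fact p.Prime] {m : ℕ} (h : FourthPowerCase G p m) :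
    (relCommDegrees G).ncard = 5 := by
  have hp : p.Prime := Fact.out
  have := Fintype.ofFinite G
  have := Fintype.ofFinite (G ⧸ center G)
  rw [relCommDegrees_eq_range_deg]
  exact le_antisymm (CommSystem.ncard_range_deg_le_of_const h.1 h.index_eq)
    (faithful_centerQuotientSystem.lt_ncard_range_deg h.1)

theorem cubeCase_or_fourthPowerCase [Group.IsNilpotent G] (h5 : (relCommDegrees G).ncard = 5) :
    (∃ p : ℕ, p.Prime ∧ CubeCase G p) ∨ (∃ p m : ℕ, p.Prime ∧ FourthPowerCase G p m) := by
  have := Fintype.ofFinite G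
  have := Fintype.ofFinite (G ⧸ center G)
  obtain ⟨p, n, hp, hn⟩ : ∃ p n : ℕ, p.Prime ∧ Nat.card (G ⧸ center G) = p ^ n := by
    by_cases h1 : Nat.card (G ⧸ center G) = 1
    -- The prime is a dummy; exponent 0 is ruled out below.
    · exact ⟨2, 0, Nat.prime_two, h1⟩
    · obtain ⟨p, hp, hpd⟩ := Nat.exists_prime_and_dvd h1
      exact ⟨p, _, hp, Nat.eq_prime_pow_of_unique_prime_dvd Nat.card_pos.ne' fun hq hqd =>
        eq_of_prime_dvd_card_quotient_center h5 hq hp hqd hpd⟩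
  have : Fact p.Prime := ⟨hp⟩
  rw [relCommDegrees_eq_range_deg] at h5
  rcases faithful_centerQuotientSystem.exponent_eq_of_ncard hn h5 with ⟨rfl, x, hx⟩ | rfl
  · exact Or.inl ⟨p, hp, cubeCase_of_index_eq hn hx⟩
  · obtain ⟨m, hm, hc⟩ := faithful_centerQuotientSystem.exists_index_eq_of_ncard hn h5
    exact Or.inr ⟨p, m, hp, fourthPowerCase_of_index_eq hm hn hc⟩

end Main

theorem mainTheorem2 (G : Type*) [Group G] [Finite G] [Group.IsNilpotent G] :
    ((relCommDegrees G).ncard = 5 ↔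
      (∃ p : ℕ, p.Prime ∧ CubeCase G p) ∨
        (∃ p m : ℕ, p.Prime ∧ FourthPowerCase G p m)) ∧
    (∀ p : ℕ, p.Prime → CubeCase G p →
      relCommDegrees G =
        {1, (2 * (p : ℚ) - 1) / (p : ℚ) ^ 2,
          ((p : ℚ) ^ 2 + (p : ℚ) - 1) / (p : ℚ) ^ 3,
          (3 * (p : ℚ) - 2) / (p : ℚ) ^ 3,
          (2 * (p : ℚ) ^ 2 - 1) / (p : ℚ) ^ 4}) ∧
    (∀ p m : ℕ, p.Prime → FourthPowerCase G p m →
      relCommDegrees G =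
        {1, ((p : ℚ) ^ m + (p : ℚ) - 1) / (p : ℚ) ^ (m + 1),
          ((p : ℚ) ^ m + (p : ℚ) ^ 2 - 1) / (p : ℚ) ^ (m + 2),
          ((p : ℚ) ^ m + (p : ℚ) ^ 3 - 1) / (p : ℚ) ^ (m + 3),
          ((p : ℚ) ^ m + (p : ℚ) ^ 4 - 1) / (p : ℚ) ^ (m + 4)}) := by
  refine ⟨⟨cubeCase_or_fourthPowerCase, ?_⟩, fun p hp h => ?_, fun p m hp h => ?_⟩
  · rintro (⟨p, hp, h⟩ | ⟨p, m, hp, h⟩)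
    · have : Fact p.Prime := ⟨hp⟩
      exact h.ncard_relCommDegrees
    · have : Fact p.Prime := ⟨hp⟩
      exact h.ncard_relCommDegrees
  · have : Fact p.Prime := ⟨hp⟩
    exact h.relCommDegrees_eq
  · have : Fact p.Prime := ⟨hp⟩
    exact h.relCommDegrees_eq
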